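/- For positive integers $m,n$ let $\mathrm{S}(m,n)$ be the Baumslag--Solitar semigroup, presented as a semigroup by $\langle x,y \mid yx^m = x^ny\rangle$. If $m<n$, then every finitely generated subsemigroup of $\mathrm{S}(m,n)$ is left-automatic. Here a semigroup $S$ is left-automatic if there are a finite alphabet $A$ representing a set of generators for $S$ (write $\overline{w}\in S$ for the element represented by $w\in A^+$) and a regular language $L\subseteq A^+$ such that $\overline{L}=S$ and, for each $a\in A\cup\{\varepsilon\}$, where $\varepsilon$ is the empty word, the set $\{(u,v)\delta_A : u,v\in L,\ \overline{au}=\overline{v}\}$ is a regular language over the alphabet $\{(b,c) : b,c\in A\cup\{\$\}\}\setminus\{(\$,\$)\}$. The map $\delta_A$ sends a pair of words $(u,v)$ to the word of pairs obtained by reading $u$ and $v$ in parallel from their first letters, the shorter word being filled up on the right with the new padding symbol $\$\notin A$. -/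

import Mathlib

/-- The semigroup presented by the generators `X` and the set `R` of defining relations: the
quotient of the free semigroup on `X` by the smallest congruence containing `R`. -/
abbrev PresentedSemigroup {X : Type*} (R : Set (FreeSemigroup X × FreeSemigroup X)) : Type _ :=
  (conGen fun u v => (u, v) ∈ R).Quotient

namespace BaumslagSolitar

/-- The two generators `x` and `y`. -/
inductive Gen : Type
  | x
  | y

/-- The word `y x ^ k`. -/
def yxPow : ℕ → FreeSemigroup Gen
  | 0 => FreeSemigroup.of Gen.y
  | k + 1 => yxPow k * FreeSemigroup.of Gen.x

/-- The word `x ^ k y`. -/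
def xPowY : ℕ → FreeSemigroup Gen
  | 0 => FreeSemigroup.of Gen.y
  | k + 1 => FreeSemigroup.of Gen.x * xPowY k

end BaumslagSolitar

/-- The Baumslag–Solitar semigroup `S(m, n)`, presented as a semigroup by the generators `x`, `y`
and the single relation `y x ^ m = x ^ n y`. -/
abbrev BaumslagSolitarSemigroup (m n : ℕ) : Type :=
  PresentedSemigroup {(BaumslagSolitar.yxPow m, BaumslagSolitar.xPowY n)}

/-- A subsemigroup is finitely generated if it is generated by a finite set. -/
def Subsemigroup.IsFinitelyGenerated {S : Type*} [Semigroup S] (T : Subsemigroup S) : Prop :=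
  ∃ X : Set S, X.Finite ∧ Subsemigroup.closure X = T

namespace AutomaticSemigroup

/-- The list of letters of a nonempty word. -/
def letters {A : Type*} (w : FreeSemigroup A) : List A :=
  w.head :: w.tail

/-- The padded alphabet `A(2, $)`: all pairs over `A ∪ {$}` other than `($, $)`. The padding
symbol `$` is `none`. -/
abbrev PadAlphabet (A : Type*) : Type _ :=
  {p : Option A × Option A // p ≠ (none, none)}

/-- The padding map `δ` on lists of letters: the two words are read in parallel, and the shorter
one is filled up on the right with the padding symbol. -/
def pad {A : Type*} : List A → List A → List (PadAlphabet A)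
  | [], [] => []
  | a :: u, [] => ⟨(some a, none), by simp⟩ :: pad u []
  | [], b :: v => ⟨(none, some b), by simp⟩ :: pad [] v
  | a :: u, b :: v => ⟨(some a, some b), by simp⟩ :: pad u v

/-- The set of lists of letters of the words in `L ⊆ A⁺`, as a formal language over `A`. -/
def wordLanguage {A : Type*} (L : Set (FreeSemigroup A)) : Language A :=
  {l | ∃ w ∈ L, letters w = l}

/-- The image `R δ` of a relation `R ⊆ A⁺ × A⁺` under the padding map, as a formal language over
`A(2, $)`. -/
def padLanguage {A : Type*} (R : Set (FreeSemigroup A × FreeSemigroup A)) :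
    Language (PadAlphabet A) :=
  {l | ∃ u v, (u, v) ∈ R ∧ pad (letters u) (letters v) = l}

/-- `(A, L)` is a left-automatic structure for the semigroup `S`, where the letters of the
alphabet `A` represent elements of `S` by way of `φ : A → S`. The element represented by the
word `w ∈ A⁺` is `FreeSemigroup.lift φ w`. -/
structure IsLeftAutomaticStructure {S : Type*} [Semigroup S] {A : Type*} (φ : A → S)
    (L : Set (FreeSemigroup A)) : Prop where
  finite_alphabet : Finite A
  generates : Subsemigroup.closure (Set.range φ) = ⊤
  regular : (wordLanguage L).IsRegular
  surjective : FreeSemigroup.lift φ '' L = Set.univ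
  regular_eq : (padLanguage {p | p.1 ∈ L ∧ p.2 ∈ L ∧
    FreeSemigroup.lift φ p.1 = FreeSemigroup.lift φ p.2}).IsRegular
  regular_mul : ∀ a : A, (padLanguage {p | p.1 ∈ L ∧ p.2 ∈ L ∧
    FreeSemigroup.lift φ (FreeSemigroup.of a * p.1) = FreeSemigroup.lift φ p.2}).IsRegular

end AutomaticSemigroup

/-- A semigroup is left-automatic if it admits a left-automatic structure. -/
def IsLeftAutomatic (S : Type*) [Semigroup S] : Prop :=
  ∃ (A : Type) (φ : A → S) (L : Set (FreeSemigroup A)),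
    AutomaticSemigroup.IsLeftAutomaticStructure φ L

namespace Language

variable {α : Type*}

/-- A member of a finite family of languages that is closed under left quotients by letters is
regular. -/
theorem isRegular_of_mem_finite {F : Set (Language α)} (hF : F.Finite)
    (h : ∀ K ∈ F, ∀ a, K.leftQuotient [a] ∈ F) {K : Language α} (hK : K ∈ F) : K.IsRegular := by
  refine IsRegular.of_finite_range_leftQuotient (hF.subset ?_)
  rintro _ ⟨w, rfl⟩
  induction w using List.reverseRecOn with
  | nil => exact hK
  | append_singleton w a ih => rw [leftQuotient_append]; exact h _ ih a

end Language

namespace AutomaticSemigroup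

variable {A : Type*}

theorem pad_eq_pad_take_append_pad_drop (u v : List A) (j : ℕ) :
    pad u v = pad (u.take j) (v.take j) ++ pad (u.drop j) (v.drop j) := by
  induction j generalizing u v with
  | zero => simp [pad]
  | succ j ih =>
    cases u with
    | nil =>
      cases v with
      | nil => simp [pad]
      | cons b v =>
        have := ih [] v
        simp only [List.take_nil, List.drop_nil] at this
        simpa [pad] using this
    | cons a u =>
      cases v with
      | nil =>
        have := ih u []
        simp only [List.take_nil, List.drop_nil] at this
        simpa [pad] using this
      | cons b v => simpa [pad] using ih u v

theorem length_pad (u v : List A) : (pad u v).length = max u.length v.length := by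
  induction u generalizing v with
  | nil =>
    induction v with
    | nil => simp [pad]
    | cons b v ih => simp only [pad, List.length_cons, List.length_nil] at ih ⊢; omega
  | cons a u ih =>
    cases v with
    | nil => have := ih []; simp only [pad, List.length_cons, List.length_nil] at this ⊢; omega
    | cons b v => simp [pad, ih v]

/-- The first component of a padded pair of words. -/
def unpadLeft (p : List (PadAlphabet A)) : List A :=
  p.filterMap fun x => x.1.1

/-- The second component of a padded pair of words. -/
def unpadRight (p : List (PadAlphabet A)) : List A :=
  p.filterMap fun x => x.1.2

theorem unpadLeft_pad (u v : List A) : unpadLeft (pad u v) = u := by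
  induction u generalizing v with
  | nil =>
    induction v with
    | nil => simp [pad, unpadLeft]
    | cons b v ih => simpa [pad, unpadLeft] using ih
  | cons a u ih =>
    cases v with
    | nil => simpa [pad, unpadLeft] using ih []
    | cons b v => simpa [pad, unpadLeft] using ih v

theorem unpadRight_pad (u v : List A) : unpadRight (pad u v) = v := by
  induction u generalizing v with
  | nil =>
    induction v with
    | nil => simp [pad, unpadRight]
    | cons b v ih => simpa [pad, unpadRight] using ih
  | cons a u ih =>
    cases v with
    | nil => simpa [pad, unpadRight] using ih []
    | cons b v => simpa [pad, unpadRight] using ih v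

theorem pad_eq_append {u v : List A} {p s : List (PadAlphabet A)} (h : pad u v = p ++ s) :
    p = pad (u.take p.length) (v.take p.length) ∧ s = pad (u.drop p.length) (v.drop p.length) := by
  rw [pad_eq_pad_take_append_pad_drop u v p.length] at h
  have hl := congrArg List.length (pad_eq_pad_take_append_pad_drop u v p.length)
  have hl' := congrArg List.length h
  simp only [List.length_append, length_pad, List.length_take, List.length_drop] at hl hl'
  obtain ⟨h₁, h₂⟩ := List.append_inj' h (by simp only [length_pad, List.length_drop]; omega)
  exact ⟨h₁.symm, h₂.symm⟩

variable {M : Type*} [Monoid M]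

/-- The language of padded pairs `(u, v)` of words in `L` with `g * u = v` in the monoid `M`. -/
def mulLanguage (ψ : A → M) (L : Language A) (g : M) : Language (PadAlphabet A) :=
  {l | ∃ u v, u ∈ L ∧ v ∈ L ∧ g * (u.map ψ).prod = (v.map ψ).prod ∧ pad u v = l}

/-- The padded pairs whose components lie in given languages, satisfy a given relation, and are
empty where this is asked for. -/
def restrictedPadLanguage
    (k : Language A × Language A × Prop × Prop × Set (List A × List A)) :
    Language (PadAlphabet A) :=
  {s | ∃ u v, u ∈ k.1 ∧ v ∈ k.2.1 ∧ (k.2.2.1 → u = []) ∧ (k.2.2.2.1 → v = []) ∧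
    (u, v) ∈ k.2.2.2.2 ∧ pad u v = s}

theorem leftQuotient_mulLanguage (ψ : A → M) (L : Language A) (g : M) (p : List (PadAlphabet A))
    (hp : p = pad (unpadLeft p) (unpadRight p)) :
    (mulLanguage ψ L g).leftQuotient p = restrictedPadLanguage
      (L.leftQuotient (unpadLeft p), L.leftQuotient (unpadRight p),
        (unpadLeft p).length < p.length, (unpadRight p).length < p.length,
        {r | g * ((unpadLeft p).map ψ).prod * (r.1.map ψ).prod =
          ((unpadRight p).map ψ).prod * (r.2.map ψ).prod}) := by
  ext s
  rw [Language.mem_leftQuotient]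
  constructor
  · rintro ⟨u, v, hu, hv, huv, h⟩
    obtain ⟨h₁, h₂⟩ := pad_eq_append h
    have hl : unpadLeft p = u.take p.length := by
      conv_lhs => rw [h₁, unpadLeft_pad]
    have hr : unpadRight p = v.take p.length := by
      conv_lhs => rw [h₁, unpadRight_pad]
    refine ⟨u.drop p.length, v.drop p.length, ?_, ?_, ?_, ?_, ?_, h₂.symm⟩
    · simpa [hl] using hu
    · simpa [hr] using hv
    · simp only [hl, List.length_take, List.drop_eq_nil_iff]; omega
    · simp only [hr, List.length_take, List.drop_eq_nil_iff]; omega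
    · simp only [hl, hr, Set.mem_ofPred_eq]
      rw [mul_assoc, ← List.prod_append, ← List.prod_append, ← List.map_append, ← List.map_append,
        List.take_append_drop, List.take_append_drop, huv]
  · rintro ⟨u, v, hu, hv, hul, hvl, huv, rfl⟩
    refine ⟨unpadLeft p ++ u, unpadRight p ++ v, hu, hv, ?_, ?_⟩
    · simp only [Set.mem_ofPred_eq] at huv
      rw [List.map_append, List.map_append, List.prod_append, List.prod_append, ← mul_assoc, huv]
    · have hlen : p.length = max (unpadLeft p).length (unpadRight p).length := by
        conv_lhs => rw [hp, length_pad]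
      have aux : ∀ w w' : List A, w.length ≤ p.length → (w.length < p.length → w' = []) →
          (w ++ w').take p.length = w ∧ (w ++ w').drop p.length = w' := by
        intro w w' h₁ h₂
        obtain h | h := h₁.lt_or_eq
        · simp [h₂ h, h₁]
        · simp [← h]
      obtain ⟨h₁, h₂⟩ := aux _ _ (by omega) hul
      obtain ⟨h₃, h₄⟩ := aux _ _ (by omega) hvl
      rw [pad_eq_pad_take_append_pad_drop _ _ p.length, h₁, h₂, h₃, h₄, ← hp]

/-- If words in a regular language over generators of a left-cancellative monoid which differ by
left multiplication by `g` fellow-travel, then the corresponding padded language is regular. -/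
theorem isRegular_mulLanguage [IsLeftCancelMul M] (ψ : A → M) {L : Language A} (hL : L.IsRegular)
    (g : M) {F : Set (M × M)} (hF : F.Finite)
    (h : ∀ u ∈ L, ∀ v ∈ L, g * (u.map ψ).prod = (v.map ψ).prod → ∀ j : ℕ, ∃ k, ∃ pq ∈ F,
      g * ((u.take j).map ψ).prod = k * pq.1 ∧ ((v.take j).map ψ).prod = k * pq.2) :
    (mulLanguage ψ L g).IsRegular := by
  let Q : M × M → Set (List A × List A) := fun pq =>
    {r | pq.1 * (r.1.map ψ).prod = pq.2 * (r.2.map ψ).prod}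
  have hfin : (Set.range L.leftQuotient).Finite := hL.finite_range_leftQuotient
  have hkeys := hfin.prod (hfin.prod
    ((Set.finite_univ (α := Prop)).prod ((Set.finite_univ (α := Prop)).prod (hF.image Q))))
  refine .of_finite_range_leftQuotient
    (((hkeys.image restrictedPadLanguage).insert ⊥).subset ?_)
  rintro _ ⟨p, rfl⟩
  by_cases hp : ∃ s, p ++ s ∈ mulLanguage ψ L g
  · right
    obtain ⟨s, u, v, hu, hv, huv, hs⟩ := hp
    obtain ⟨h₁, -⟩ := pad_eq_append hs
    have hl : unpadLeft p = u.take p.length := by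
      conv_lhs => rw [h₁, unpadLeft_pad]
    have hr : unpadRight p = v.take p.length := by
      conv_lhs => rw [h₁, unpadRight_pad]
    refine ⟨_, ⟨⟨_, rfl⟩, ⟨_, rfl⟩, trivial, trivial, ?_⟩,
      (leftQuotient_mulLanguage ψ L g p (by rwa [hl, hr])).symm⟩
    obtain ⟨k, pq, hpq, e₁, e₂⟩ := h u hu v hv huv p.length
    refine ⟨pq, hpq, ?_⟩
    ext r
    simp only [Q, Set.mem_ofPred_eq, hl, hr, e₁, e₂, mul_assoc, mul_right_inj]
  · left
    ext s
    exact ⟨fun hs => (hp ⟨s, hs⟩).elim, fun hs => hs.elim⟩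

end AutomaticSemigroup

namespace BaumslagSolitar

section NormalForm

variable (m : ℕ) {n : ℕ} [NeZero n]

/-- The digits of the normal form of `x ^ k * w`, where `ds` are the digits of `w`. -/
def shiftDigits : ℕ → List (Fin n) → List (Fin n)
  | _, [] => []
  | k, d :: ds => Fin.ofNat n (d + k) :: shiftDigits (m * ((d + k) / n)) ds

/-- The power of `x` that is pushed out on the right when `x ^ k` is multiplied by a word with
digits `ds`. -/
def carryOut : ℕ → List (Fin n) → ℕ
  | k, [] => k
  | k, d :: ds => carryOut (m * ((d + k) / n)) ds

/-- The action of `x ^ k` on normal forms. -/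
def shift (k : ℕ) (z : List (Fin n) × ℕ) : List (Fin n) × ℕ :=
  (shiftDigits m k z.1, z.2 + carryOut m k z.1)

@[simp]
theorem length_shiftDigits (k : ℕ) (ds : List (Fin n)) :
    (shiftDigits m k ds).length = ds.length := by
  induction ds generalizing k with
  | nil => rfl
  | cons d ds ih => simp [shiftDigits, ih]

theorem add_mod_carry (d k j : ℕ) :
    m * (((d + k) % n + j) / n) + m * ((d + k) / n) = m * ((d + (j + k)) / n) := by
  rw [← mul_add]
  congr 1
  have h := Nat.div_add_mod (d + k) n
  rw [← Nat.add_mul_div_left _ _ (Nat.pos_of_neZero n)]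
  congr 1
  omega

theorem shift_shift (j k : ℕ) (z : List (Fin n) × ℕ) :
    shift m j (shift m k z) = shift m (j + k) z := by
  obtain ⟨ds, c⟩ := z
  induction ds generalizing j k with
  | nil => simp [shift, shiftDigits, carryOut]; omega
  | cons d ds ih =>
    have := ih (m * (((d + k) % n + j) / n)) (m * ((d + k) / n))
    rw [add_mod_carry] at this
    simp only [shift, Prod.mk.injEq] at this
    simp only [shift, shiftDigits, carryOut, Fin.val_ofNat, Prod.mk.injEq, List.cons.injEq]
    refine ⟨⟨?_, this.1⟩, this.2⟩
    ext
    simp only [Fin.val_ofNat, Nat.mod_add_mod]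
    congr 1; omega

@[simp]
theorem shift_zero (z : List (Fin n) × ℕ) : shift m 0 z = z := by
  obtain ⟨ds, c⟩ := z
  induction ds with
  | nil => rfl
  | cons d ds ih =>
    simp only [shift, Prod.mk.injEq] at ih
    simp [shift, shiftDigits, carryOut, Nat.div_eq_of_lt d.2, ih]

theorem shift_injective (k : ℕ) : Function.Injective (shift (n := n) m k) := by
  rintro ⟨ds, c⟩ ⟨ds', c'⟩ h
  induction ds generalizing k ds' with
  | nil =>
    have hl := congrArg (fun z => z.1.length) h
    simp only [shift, length_shiftDigits, List.length_nil] at hl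
    obtain rfl := List.length_eq_zero_iff.1 hl.symm
    simpa [shift, shiftDigits, carryOut] using h
  | cons d ds ih =>
    cases ds' with
    | nil => simp [shift, shiftDigits] at h
    | cons d' ds' =>
      simp only [shift, shiftDigits, carryOut, Prod.mk.injEq, List.cons.injEq] at h
      have hd : d = d' := by
        have h₁ := congrArg Fin.val h.1.1
        simp only [Fin.val_ofNat] at h₁
        have h₂ : (d : ℕ) % n = d' % n := Nat.ModEq.add_right_cancel' k h₁
        rw [Nat.mod_eq_of_lt d.2, Nat.mod_eq_of_lt d'.2] at h₂
        exact Fin.ext h₂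
      subst hd
      have := ih _ _ (Prod.ext h.1.2 h.2)
      simp_all

/-- The action of `y` on normal forms. -/
def consZero (z : List (Fin n) × ℕ) : List (Fin n) × ℕ :=
  (0 :: z.1, z.2)

theorem consZero_injective : Function.Injective (consZero (n := n)) := by
  rintro ⟨ds, c⟩ ⟨ds', c'⟩ h
  simpa [consZero] using h

theorem consZero_shift (z : List (Fin n) × ℕ) :
    consZero (shift m m z) = shift m n (consZero z) := by
  simp [consZero, shift, shiftDigits, carryOut, Nat.div_self (Nat.pos_of_neZero n)]

/-- The action of the generators on normal forms. -/
def genAct : Gen → Function.End (List (Fin n) × ℕ)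
  | .x => shift m 1
  | .y => consZero

theorem lift_genAct_yxPow (k : ℕ) (z : List (Fin n) × ℕ) :
    FreeSemigroup.lift (genAct (n := n) m) (yxPow k) z = consZero (shift m k z) := by
  induction k generalizing z with
  | zero => simp [yxPow, genAct]
  | succ k ih =>
    rw [yxPow, map_mul]
    exact (ih (shift m 1 z)).trans (by rw [shift_shift])

theorem lift_genAct_xPowY (k : ℕ) (z : List (Fin n) × ℕ) :
    FreeSemigroup.lift (genAct (n := n) m) (xPowY k) z = shift m k (consZero z) := by
  induction k generalizing z with
  | zero => simp [xPowY, genAct]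
  | succ k ih =>
    rw [xPowY, map_mul]
    exact (congrArg (shift m 1) (ih z)).trans (by rw [shift_shift, add_comm])

end NormalForm

end BaumslagSolitar

namespace BaumslagSolitar

section Carry

variable {m n : ℕ}

theorem carryOut_le_of_le (hmn : m < n) {E : ℕ} (hE : n * m ≤ E) (ds : List (Fin n)) {k : ℕ}
    (hk : k ≤ E) : carryOut m k ds ≤ E := by
  induction ds generalizing k with
  | nil => exact hk
  | cons d ds ih =>
    refine ih ?_
    have hd := d.2
    have h₁ : n * ((d + k) / n) ≤ d + k := Nat.mul_div_le _ _
    generalize ((d : ℕ) + k) / n = q at h₁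
    by_contra! h
    obtain hq | hq := le_or_gt q m
    · nlinarith
    · nlinarith

theorem carryOut_le_add (hmn : m < n) (ds : List (Fin n)) (k : ℕ) :
    carryOut m k ds ≤ k + n * m :=
  carryOut_le_of_le hmn (Nat.le_add_left _ _) ds (Nat.le_add_right _ _)

theorem carryOut_add_le (hmn : m < n) {K : ℕ} {ds : List (Fin n)} (hds : ds ≠ []) {k : ℕ}
    (hk : k ≤ n * (K + m)) : carryOut m k ds + K ≤ n * (K + m) := by
  induction ds generalizing k with
  | nil => exact absurd rfl hds
  | cons d ds ih =>
    have key : m * ((d + k) / n) + K ≤ n * (K + m) := by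
      have hd := d.2
      have h₁ : n * ((d + k) / n) ≤ d + k := Nat.mul_div_le _ _
      generalize ((d : ℕ) + k) / n = q at h₁
      have hq : q ≤ K + m := by
        by_contra! h
        nlinarith
      nlinarith
    by_cases h : ds = []
    · subst h; exact key
    · exact ih h (by omega)

theorem shift_pow_mul [NeZero n] (ds : List (Fin n)) (q c : ℕ) :
    shift m (n ^ ds.length * q) (ds, c) = (ds, c + m ^ ds.length * q) := by
  induction ds generalizing q with
  | nil => simp [shift, shiftDigits, carryOut]
  | cons d ds ih =>
    have h₁ : n ^ (ds.length + 1) * q = n * (n ^ ds.length * q) := by ring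
    have h₂ : m * (n ^ ds.length * q) = n ^ ds.length * (m * q) := by ring
    have h₃ : Fin.ofNat n (d + n * (n ^ ds.length * q)) = d := by
      ext; simp [Nat.mod_eq_of_lt d.2]
    have := ih (m * q)
    simp only [shift, Prod.mk.injEq] at this
    simp only [shift, shiftDigits, carryOut, List.length_cons, h₁, h₃,
      Nat.add_mul_div_left _ _ (Nat.pos_of_neZero n), Nat.div_eq_of_lt d.2, zero_add, h₂, this]
    ring_nf

end Carry

section Monoid

variable (m n : ℕ)

/-- The Baumslag–Solitar monoid. -/
abbrev BSMonoid : Type := WithOne (BaumslagSolitarSemigroup m n)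

variable {n} in
/-- The element of the Baumslag–Solitar monoid represented by a generator. -/
def gen (g : Gen) : BSMonoid m n :=
  ((FreeSemigroup.of g : FreeSemigroup Gen) : BaumslagSolitarSemigroup m n)

variable {m n}

@[elab_as_elim]
theorem gen_induction {p : BSMonoid m n → Prop} (one : p 1)
    (gen_mul : ∀ g z, p z → p (gen m g * z)) (z : BSMonoid m n) : p z := by
  refine WithOne.cases_on z one fun q => Con.induction_on q fun w => ?_
  induction w with
  | ih1 g =>
    have h := gen_mul g 1 one
    rw [mul_one] at h
    exact h
  | ih2 g w _ hw => exact gen_mul g _ hw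

theorem gen_y_mul_gen_x_pow :
    (gen m .y * gen m .x ^ m : BSMonoid m n) = gen m .x ^ n * gen m .y := by
  have h₁ : ∀ k, ((yxPow k : BaumslagSolitarSemigroup m n) : BSMonoid m n) =
      gen m .y * gen m .x ^ k := by
    intro k
    induction k with
    | zero => exact (mul_one _).symm
    | succ k ih => rw [pow_succ, ← mul_assoc, ← ih]; rfl
  have h₂ : ∀ k, ((xPowY k : BaumslagSolitarSemigroup m n) : BSMonoid m n) =
      gen m .x ^ k * gen m .y := by
    intro k
    induction k with
    | zero => exact (one_mul _).symm
    | succ k ih => rw [pow_succ', mul_assoc, ← ih]; rfl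
  rw [← h₁, ← h₂]
  congr 1
  exact (Con.eq _).2 (ConGen.Rel.of _ _ rfl)

/-- The element with the given normal form. -/
def ofNF (z : List (Fin n) × ℕ) : BSMonoid m n :=
  (z.1.map fun d : Fin n => gen m .x ^ (d : ℕ) * gen m .y).prod * gen m .x ^ z.2

theorem gen_y_mul_gen_x_pow_mul (q : ℕ) :
    (gen m .y * gen m .x ^ (m * q) : BSMonoid m n) = gen m .x ^ (n * q) * gen m .y := by
  induction q with
  | zero => simp
  | succ q ih =>
    rw [mul_add, pow_add, ← mul_assoc, ih, mul_assoc, mul_one, gen_y_mul_gen_x_pow, ← mul_assoc,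
      ← pow_add, mul_add, mul_one]

theorem ofNF_append (ds e : List (Fin n)) (c : ℕ) :
    (ofNF (ds ++ e, c) : BSMonoid m n) = ofNF (ds, 0) * ofNF (e, c) := by
  simp [ofNF, mul_assoc]

theorem ofNF_add (ds : List (Fin n)) (a b : ℕ) :
    (ofNF (ds, a + b) : BSMonoid m n) = ofNF (ds, a) * gen m .x ^ b := by
  simp [ofNF, mul_assoc, pow_add]

variable [NeZero n]

variable (m n) in
/-- The action of the Baumslag–Solitar semigroup on normal forms, by left multiplication. -/
def semigroupAct : BaumslagSolitarSemigroup m n →ₙ* Function.End (List (Fin n) × ℕ) where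
  toFun q := Con.liftOn q (FreeSemigroup.lift (genAct m)) <| by
    intro a b h
    have : conGen (fun u v => (u, v) ∈ ({(yxPow m, xPowY n)} : Set (FreeSemigroup Gen × _))) ≤
        Con.ker (FreeSemigroup.lift (genAct (n := n) m)) := by
      rw [Con.conGen_le]
      rintro u v huv
      obtain ⟨rfl, rfl⟩ := Prod.mk.injEq .. ▸ Set.mem_singleton_iff.1 huv
      refine funext fun z => ?_
      rw [lift_genAct_yxPow, lift_genAct_xPowY, consZero_shift]
    exact this h
  map_mul' a b := Con.induction_on₂ a b fun u v => map_mul (FreeSemigroup.lift (genAct m)) u v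

variable (m n) in
/-- The action of the Baumslag–Solitar monoid on normal forms, by left multiplication. -/
def act : BSMonoid m n →* Function.End (List (Fin n) × ℕ) :=
  WithOne.lift (semigroupAct m n)

theorem act_gen (g : Gen) : act m n (gen m g) = genAct m g := rfl

theorem act_gen_x_pow (k : ℕ) : act m n (gen m .x ^ k) = shift m k := by
  induction k with
  | zero => funext z; rw [pow_zero, map_one, shift_zero]; rfl
  | succ k ih =>
    rw [pow_succ, map_mul, ih, act_gen]
    exact funext fun z => shift_shift m k 1 z

theorem ofNF_shift (k : ℕ) (z : List (Fin n) × ℕ) :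
    (ofNF (shift m k z) : BSMonoid m n) = gen m .x ^ k * ofNF z := by
  obtain ⟨ds, c⟩ := z
  induction ds generalizing k with
  | nil => simp [ofNF, shift, shiftDigits, carryOut, ← pow_add, add_comm]
  | cons d ds ih =>
    have h := ih (m * ((d + k) / n))
    simp only [ofNF, shift, shiftDigits, carryOut, List.map_cons, List.prod_cons, Fin.val_ofNat]
      at h ⊢
    rw [mul_assoc, h, ← mul_assoc, ← mul_assoc, mul_assoc _ (gen m .y), gen_y_mul_gen_x_pow_mul,
      ← mul_assoc (gen m .x ^ _), ← pow_add, Nat.mod_add_div, add_comm (d : ℕ) k, pow_add]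
    simp only [mul_assoc]

theorem ofNF_consZero (z : List (Fin n) × ℕ) :
    (ofNF (consZero z) : BSMonoid m n) = gen m .y * ofNF z := by
  simp [ofNF, consZero, mul_assoc]

theorem ofNF_act (s : BSMonoid m n) (z : List (Fin n) × ℕ) : ofNF (act m n s z) = s * ofNF z := by
  induction s using gen_induction with
  | one => rw [map_one, one_mul]; rfl
  | gen_mul g s ih =>
    rw [map_mul, mul_assoc, ← ih]
    cases g
    · exact (ofNF_shift 1 _).trans (by rw [pow_one])
    · exact ofNF_consZero _

/-- The normal form of an element of the Baumslag–Solitar monoid. -/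
def nf (s : BSMonoid m n) : List (Fin n) × ℕ :=
  act m n s ([], 0)

@[simp]
theorem ofNF_nf (s : BSMonoid m n) : ofNF (nf s) = s := by
  rw [nf, ofNF_act]
  simp [ofNF]

theorem nf_injective : Function.Injective (nf (m := m) (n := n)) :=
  Function.LeftInverse.injective ofNF_nf

theorem act_injective (s : BSMonoid m n) : Function.Injective (act m n s) := by
  induction s using gen_induction with
  | one => rw [map_one]; exact Function.injective_id
  | gen_mul g s ih =>
    rw [map_mul]
    refine Function.Injective.comp ?_ ih
    cases g
    · exact shift_injective m 1
    · exact consZero_injective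

theorem nf_mul_eq_act (s t : BSMonoid m n) : nf (s * t) = act m n s (nf t) := by
  rw [nf, map_mul]; rfl

instance : IsLeftCancelMul (BSMonoid m n) where
  mul_left_cancel s t u h := nf_injective <| act_injective s <| by
    rw [← nf_mul_eq_act, ← nf_mul_eq_act]; exact congrArg nf h

theorem act_ofNF (w z : List (Fin n) × ℕ) :
    act m n (ofNF w) z = (w.1 ++ (shift m w.2 z).1, (shift m w.2 z).2) := by
  obtain ⟨ds, c⟩ := w
  induction ds with
  | nil => simp [ofNF, act_gen_x_pow]
  | cons d ds ih =>
    have h : (ofNF (d :: ds, c) : BSMonoid m n) =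
        gen m .x ^ (d : ℕ) * (gen m .y * ofNF (ds, c)) := by
      simp [ofNF, mul_assoc]
    rw [h, map_mul, act_gen_x_pow, map_mul, act_gen]
    change shift m d (consZero (act m n (ofNF (ds, c)) z)) = _
    rw [ih]
    have h₀ := shift_zero m (ds ++ (shift m c z).1, (shift m c z).2)
    simp only [shift, Prod.mk.injEq] at h₀
    simp [consZero, shift, shiftDigits, carryOut, Nat.div_eq_of_lt d.2, h₀]

@[simp]
theorem nf_ofNF (z : List (Fin n) × ℕ) : nf (ofNF z : BSMonoid m n) = z := by
  rw [nf, act_ofNF]; simp [shift, shiftDigits, carryOut]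

/-- The digits of the normal form. -/
def digits (s : BSMonoid m n) : List (Fin n) := (nf s).1

/-- The number of occurrences of `y` in words representing a given element. -/
def yCount (s : BSMonoid m n) : ℕ := (digits s).length

/-- The exponent of `x` at the end of the normal form. -/
def tailExp (s : BSMonoid m n) : ℕ := (nf s).2

theorem ofNF_digits_tailExp (s : BSMonoid m n) : ofNF (digits s, tailExp s) = s := ofNF_nf s

theorem ext_nf {s t : BSMonoid m n} (h₁ : digits s = digits t) (h₂ : tailExp s = tailExp t) :
    s = t := nf_injective (Prod.ext h₁ h₂)

theorem nf_mul (s t : BSMonoid m n) :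
    nf (s * t) = (digits s ++ (shift m (tailExp s) (nf t)).1, (shift m (tailExp s) (nf t)).2) := by
  rw [nf_mul_eq_act]
  conv_lhs => rw [← ofNF_nf s, act_ofNF]
  rfl

theorem digits_mul (s t : BSMonoid m n) :
    digits (s * t) = digits s ++ shiftDigits m (tailExp s) (digits t) :=
  congrArg Prod.fst (nf_mul s t)

theorem tailExp_mul (s t : BSMonoid m n) :
    tailExp (s * t) = tailExp t + carryOut m (tailExp s) (digits t) :=
  congrArg Prod.snd (nf_mul s t)

@[simp]
theorem yCount_mul (s t : BSMonoid m n) : yCount (s * t) = yCount s + yCount t := by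
  simp [yCount, digits_mul]

@[simp]
theorem digits_one : digits (1 : BSMonoid m n) = [] := rfl

@[simp]
theorem yCount_one : yCount (1 : BSMonoid m n) = 0 := rfl

@[simp]
theorem tailExp_one : tailExp (1 : BSMonoid m n) = 0 := rfl

theorem nf_gen_x_pow (k : ℕ) : nf (gen m .x ^ k : BSMonoid m n) = ([], k) := by
  rw [nf, act_gen_x_pow]; simp [shift, shiftDigits, carryOut]

@[simp]
theorem digits_gen_x_pow (k : ℕ) : digits (gen m .x ^ k : BSMonoid m n) = [] := by
  rw [digits, nf_gen_x_pow]

@[simp]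
theorem yCount_gen_x_pow (k : ℕ) : yCount (gen m .x ^ k : BSMonoid m n) = 0 := by
  simp [yCount]

@[simp]
theorem tailExp_gen_x_pow (k : ℕ) : tailExp (gen m .x ^ k : BSMonoid m n) = k := by
  rw [tailExp, nf_gen_x_pow]

theorem tailExp_mul_gen_x_pow (s : BSMonoid m n) (k : ℕ) :
    tailExp (s * gen m .x ^ k) = tailExp s + k := by
  rw [tailExp_mul, digits_gen_x_pow, tailExp_gen_x_pow, carryOut, add_comm]

theorem eq_gen_x_pow_of_yCount_eq_zero {s : BSMonoid m n} (h : yCount s = 0) :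
    s = gen m .x ^ tailExp s := by
  refine ext_nf ?_ ?_
  · rw [digits_gen_x_pow]; exact List.length_eq_zero_iff.1 h
  · simp

theorem gen_x_pow_mul_comm (s : BSMonoid m n) (q : ℕ) :
    gen m .x ^ (n ^ yCount s * q) * s = s * gen m .x ^ (m ^ yCount s * q) := by
  apply nf_injective
  rw [nf_mul_eq_act, act_gen_x_pow]
  refine (shift_pow_mul (m := m) (digits s) q (tailExp s)).trans (Prod.ext ?_ ?_)
  · exact (by simp [digits_mul, shiftDigits] : digits s = digits (s * gen m .x ^ _))
  · exact (tailExp_mul_gen_x_pow s _).symm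

theorem tailExp_gen_mul_le (hmn : m < n) (g : Gen) (s : BSMonoid m n) :
    tailExp s ≤ tailExp (gen m g * s) ∧ tailExp (gen m g * s) ≤ tailExp s + (1 + n * m) := by
  cases g
  · have h := tailExp_mul (gen m .x ^ 1) s
    have h' := carryOut_le_add hmn (digits s) 1
    rw [tailExp_gen_x_pow, pow_one] at h
    omega
  · have h : tailExp (gen m .y * s) = tailExp s := by
      rw [tailExp, nf_mul_eq_act, act_gen]; rfl
    omega

/-- Left multiplication changes the exponent at the end by a bounded amount. -/
theorem exists_tailExp_mul_le (hmn : m < n) (g : BSMonoid m n) :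
    ∃ G, ∀ s, tailExp s ≤ tailExp (g * s) ∧ tailExp (g * s) ≤ tailExp s + G := by
  induction g using gen_induction with
  | one => exact ⟨0, fun s => by simp⟩
  | gen_mul g z ih =>
    obtain ⟨G, hG⟩ := ih
    refine ⟨G + (1 + n * m), fun s => ?_⟩
    have h₁ := hG s
    have h₂ := tailExp_gen_mul_le hmn g (z * s)
    rw [mul_assoc]
    omega

theorem finite_setOf_bounded (a b : ℕ) :
    {s : BSMonoid m n | yCount s ≤ a ∧ tailExp s ≤ b}.Finite := by
  have : ({z : List (Fin n) × ℕ | z.1.length ≤ a ∧ z.2 ≤ b}).Finite :=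
    ((List.finite_length_le (Fin n) a).prod (Set.finite_Iic b)).subset fun z hz => hz
  exact Set.Finite.of_finite_image (this.subset (by rintro _ ⟨s, hs, rfl⟩; exact hs))
    nf_injective.injOn

end Monoid

end BaumslagSolitar

namespace BaumslagSolitar

variable {m n : ℕ} [NeZero n]

theorem exists_common_left_divisor_of_lt {P Q R R' : BSMonoid m n} (h : P * R = Q * R') {C : ℕ}
    (hlt : yCount P < yCount Q) (hy : yCount Q ≤ yCount P + C) (hP : tailExp P ≤ C)
    (hQ : tailExp Q ≤ C) :
    ∃ k p q, (yCount p ≤ C ∧ tailExp p ≤ C) ∧ (yCount q ≤ C ∧ tailExp q ≤ C) ∧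
      P = k * p ∧ Q = k * q := by
  have hd := congrArg digits h
  rw [digits_mul, digits_mul] at hd
  have hpre : digits P <+: digits Q :=
    List.prefix_of_prefix_length_le (hd ▸ List.prefix_append _ _) (List.prefix_append _ _) hlt.le
  obtain ⟨e, he⟩ := hpre
  refine ⟨ofNF (digits P, 0), gen m .x ^ tailExp P, ofNF (e, tailExp Q), by simpa, ?_, ?_, ?_⟩
  · have hl := congrArg List.length he
    rw [List.length_append] at hl
    simp only [yCount, tailExp, digits, nf_ofNF] at *
    omega
  · rw [← ofNF_add, zero_add, ofNF_digits_tailExp]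
  · rw [← ofNF_append, he, ofNF_digits_tailExp]

/-- Two left divisors of the same element whose normal forms are close to each other have a large
common left divisor. -/
theorem exists_common_left_divisor {P Q R R' : BSMonoid m n} (h : P * R = Q * R') {C : ℕ}
    (hy : yCount P ≤ yCount Q + C ∧ yCount Q ≤ yCount P + C)
    (ht : tailExp P ≤ tailExp Q + C ∧ tailExp Q ≤ tailExp P + C)
    (hne : yCount P ≠ yCount Q → tailExp P ≤ C ∧ tailExp Q ≤ C) :
    ∃ k p q, (yCount p ≤ C ∧ tailExp p ≤ C) ∧ (yCount q ≤ C ∧ tailExp q ≤ C) ∧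
      P = k * p ∧ Q = k * q := by
  obtain hlt | heq | hlt := lt_trichotomy (yCount P) (yCount Q)
  · exact exists_common_left_divisor_of_lt h hlt hy.2 (hne hlt.ne).1 (hne hlt.ne).2
  · have hd := congrArg digits h
    rw [digits_mul, digits_mul] at hd
    have hd := (List.append_inj hd heq).1
    set a := min (tailExp P) (tailExp Q) with ha
    refine ⟨ofNF (digits P, a), gen m .x ^ (tailExp P - a), gen m .x ^ (tailExp Q - a),
      ?_, ?_, ?_, ?_⟩
    · simp only [yCount_gen_x_pow, tailExp_gen_x_pow]; omega
    · simp only [yCount_gen_x_pow, tailExp_gen_x_pow]; omega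
    · rw [← ofNF_add, Nat.add_sub_cancel' (by omega), ofNF_digits_tailExp]
    · rw [← ofNF_add, Nat.add_sub_cancel' (by omega), hd, ofNF_digits_tailExp]
  · obtain ⟨k, p, q, hp, hq, h₁, h₂⟩ := exists_common_left_divisor_of_lt h.symm hlt hy.1
      (hne hlt.ne').2 (hne hlt.ne').1
    exact ⟨k, q, p, hq, hp, h₂, h₁⟩

theorem exists_remainder_bound (P : Set ℕ) {M : ℕ} (hM : 0 < M) :
    ∃ D, ∀ e ∈ P, ∃ q, ∃ r ∈ P, e = M * q + r ∧ r ≤ D := by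
  have h : ∀ i : ℕ, ∃ r, ∀ e ∈ P, e % M = i → r ∈ P ∧ r % M = i ∧ r ≤ e := by
    intro i
    by_cases hi : ∃ r, r ∈ P ∧ r % M = i
    · classical
      exact ⟨Nat.find hi, fun e he hei =>
        ⟨(Nat.find_spec hi).1, (Nat.find_spec hi).2, Nat.find_min' hi ⟨he, hei⟩⟩⟩
    · exact ⟨0, fun e he hei => (hi ⟨e, he, hei⟩).elim⟩
  choose r hr using h
  refine ⟨(Finset.range M).sup r, fun e he => ?_⟩
  obtain ⟨h₁, h₂, h₃⟩ := hr _ e he rfl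
  refine ⟨(e - r (e % M)) / M, _, h₁, ?_, Finset.le_sup (Finset.mem_range.2 (Nat.mod_lt _ hM))⟩
  rw [Nat.mul_div_cancel' ((Nat.modEq_iff_dvd' h₃).1 h₂)]
  omega

/-- A submonoid from whose elements one can split off bounded left factors: `N` and `K` bound the
factors of positive `y`-count, and the powers of `x` consist of a power of `x ^ M` and a remainder
bounded by `D`. -/
structure IsBlockDecomposable (T : Submonoid (BSMonoid m n)) (N M K D : ℕ) : Prop where
  pos : 0 < N
  lt : N < M
  exists_block : ∀ t ∈ T, yCount t ≠ 0 → ∃ h ∈ T, ∃ t' ∈ T, t = h * t' ∧ 0 < yCount h ∧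
    yCount h ≤ N ∧ tailExp h ≤ K
  exists_remainder : ∀ p, gen m .x ^ p ∈ T → ∃ q r, p = M * q + r ∧ gen m .x ^ r ∈ T ∧ r ≤ D ∧
    (q = 0 ∨ gen m .x ^ M ∈ T)

theorem exists_generator_of_yCount_ne_zero {X : Set (BSMonoid m n)} {t : BSMonoid m n}
    (ht : t ∈ Submonoid.closure X) (h : yCount t ≠ 0) :
    ∃ p, gen m .x ^ p ∈ Submonoid.closure X ∧ ∃ g ∈ X, yCount g ≠ 0 ∧
      ∃ t' ∈ Submonoid.closure X, t = gen m .x ^ p * g * t' := by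
  induction ht using Submonoid.closure_induction_left with
  | one => simp at h
  | mul_left g hg t ht ih =>
    by_cases hgy : yCount g = 0
    · obtain ⟨p, hp, g', hg', hy, t', ht', rfl⟩ := ih (by simpa [hgy] using h)
      have e := eq_gen_x_pow_of_yCount_eq_zero hgy
      refine ⟨tailExp g + p, ?_, g', hg', hy, t', ht', ?_⟩
      · rw [pow_add, ← e]; exact mul_mem (Submonoid.subset_closure hg) hp
      · rw [pow_add, ← e]; simp only [mul_assoc]
    · exact ⟨0, by simp, g, hg, hgy, t, ht, by simp⟩

theorem exists_isBlockDecomposable (hm : 0 < m) (hmn : m < n) {X : Set (BSMonoid m n)}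
    (hX : X.Finite) : ∃ N M K D, IsBlockDecomposable (Submonoid.closure X) N M K D := by
  set T := Submonoid.closure X
  obtain ⟨N, hN⟩ := (hX.image yCount).bddAbove
  obtain ⟨K, hK⟩ := (hX.image tailExp).bddAbove
  have hN : ∀ g ∈ X, yCount g ≤ N + 1 := fun g hg => Nat.le_succ_of_le (hN ⟨g, hg, rfl⟩)
  have hK : ∀ g ∈ X, tailExp g ≤ K := fun g hg => hK ⟨g, hg, rfl⟩
  obtain ⟨a, ha, haT⟩ : ∃ a, 0 < a ∧ (gen m .x ^ a ∈ T ∨ ∀ p, gen m .x ^ p ∈ T → p = 0) := by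
    by_cases h : ∃ a, 0 < a ∧ gen m .x ^ a ∈ T
    · obtain ⟨a, ha, haT⟩ := h
      exact ⟨a, ha, .inl haT⟩
    · refine ⟨1, one_pos, .inr fun p hp => ?_⟩
      by_contra hp'
      exact h ⟨p, Nat.pos_of_ne_zero hp', hp⟩
  have hM : 0 < a * n ^ (N + 1) := Nat.mul_pos ha (Nat.pow_pos (Nat.pos_of_neZero n))
  obtain ⟨D, hD⟩ := exists_remainder_bound {p | gen m .x ^ p ∈ T} hM
  have hD' : ∀ p, gen m .x ^ p ∈ T → ∃ q r, p = a * n ^ (N + 1) * q + r ∧ gen m .x ^ r ∈ T ∧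
      r ≤ D ∧ (q = 0 ∨ gen m .x ^ a ∈ T) := by
    intro p hp
    obtain ⟨q, r, hr, he, hrD⟩ := hD p hp
    refine ⟨q, r, he, hr, hrD, haT.symm.imp_left fun h => ?_⟩
    have := h p hp
    by_contra hq
    have := Nat.mul_pos hM (Nat.pos_of_ne_zero hq)
    omega
  refine ⟨N + 1, a * n ^ (N + 1), K + (D + n * m), D, Nat.succ_pos _, ?_, ?_, ?_⟩
  · exact (Nat.lt_pow_self (by omega)).trans_le (Nat.le_mul_of_pos_left _ ha)
  · intro t ht hy
    obtain ⟨p, hp, g, hg, hgy, t', ht', rfl⟩ := exists_generator_of_yCount_ne_zero ht hy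
    obtain ⟨q, r, rfl, hr, hrD, hq⟩ := hD' p hp
    have hpow : a * n ^ (N + 1) * q = n ^ yCount g * (a * n ^ (N + 1 - yCount g) * q) := by
      rw [← Nat.sub_add_cancel (hN g hg), pow_add, Nat.sub_add_cancel (hN g hg)]; ring
    refine ⟨gen m .x ^ r * g, mul_mem hr (Submonoid.subset_closure hg),
      gen m .x ^ (m ^ yCount g * (a * n ^ (N + 1 - yCount g) * q)) * t', mul_mem ?_ ht', ?_, ?_, ?_,
      ?_⟩
    · obtain rfl | hq := hq
      · simp
      · have : m ^ yCount g * (a * n ^ (N + 1 - yCount g) * q) =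
          a * (m ^ yCount g * n ^ (N + 1 - yCount g) * q) := by ring
        rw [this, pow_mul]
        exact pow_mem hq _
    · rw [add_comm, pow_add, hpow, mul_assoc (gen m .x ^ r), gen_x_pow_mul_comm]
      simp only [mul_assoc]
    · simp; omega
    · simpa using hN g hg
    · have h₁ := carryOut_le_add hmn (digits g) r
      have h₂ := hK g hg
      rw [tailExp_mul, tailExp_gen_x_pow]
      omega
  · intro p hp
    obtain ⟨q, r, he, hr, hrD, hq⟩ := hD' p hp
    exact ⟨q, r, he, hr, hrD, hq.imp_right fun h => pow_mul (gen m Gen.x) a _ ▸ pow_mem h _⟩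

/-- An element of a decomposable submonoid has a left factor with roughly a prescribed `y`-count,
unless its own `y`-count is too small. -/
theorem IsBlockDecomposable.exists_factor (hmn : m < n) {T : Submonoid (BSMonoid m n)}
    {N M K D : ℕ} (H : IsBlockDecomposable T N M K D) (τ : ℕ) {t : BSMonoid m n} (ht : t ∈ T) :
    (∃ h ∈ T, ∃ t' ∈ T, t = h * t' ∧ tailExp h ≤ n * (K + m) ∧ τ ≤ yCount h ∧
      yCount h < τ + N) ∨
    ∃ h ∈ T, ∃ p, gen m .x ^ p ∈ T ∧ t = h * gen m .x ^ p ∧ tailExp h ≤ n * (K + m) ∧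
      yCount h < τ := by
  induction τ with
  | zero =>
    exact .inl ⟨1, one_mem T, t, ht, (one_mul t).symm, by simp, by simp, by simpa using H.pos⟩
  | succ τ ih =>
    obtain ⟨h, hh, t', ht', rfl, hE, h₁, h₂⟩ | ⟨h, hh, p, hp, rfl, hE, h₁⟩ := ih
    · by_cases hτ : τ + 1 ≤ yCount h
      · exact .inl ⟨h, hh, t', ht', rfl, hE, hτ, by omega⟩
      · by_cases hy : yCount t' = 0
        · have e := eq_gen_x_pow_of_yCount_eq_zero hy
          exact .inr ⟨h, hh, tailExp t', e ▸ ht', by rw [← e], hE, by omega⟩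
        · obtain ⟨b, hb, t'', ht'', rfl, hb₁, hb₂, hb₃⟩ := H.exists_block t' ht' hy
          refine .inl ⟨h * b, mul_mem hh hb, t'', ht'', (mul_assoc _ _ _).symm, ?_, ?_, ?_⟩
          · have := carryOut_add_le hmn (List.ne_nil_of_length_pos hb₁) hE
            rw [tailExp_mul]
            omega
          · rw [yCount_mul]; omega
          · rw [yCount_mul]; omega
    · exact .inr ⟨h, hh, p, hp, rfl, hE, by omega⟩

end BaumslagSolitar

namespace BaumslagSolitar

section BlockWords

variable {A : Type*} (len : A → ℕ) (tail : Set A) (M N : ℕ)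

/-- The words over `A` that consist of a block part and a part with letters from `tail`, where the
length of a prefix of the block part stays between `0` and `N` ahead of `M` per letter when started
with the given offset. The last letter of the block part is arbitrary. -/
def IsBlockWord : ℕ → List A → Prop
  | _, [] => True
  | o, a :: w => (M ≤ o + len a ∧ o + len a ≤ M + N → IsBlockWord (o + len a - M) w) ∧
      (¬(M ≤ o + len a ∧ o + len a ≤ M + N) → ∀ b ∈ w, b ∈ tail)

/-- The language of nonempty block words. -/
def blockLanguage : Language A :=
  {w | w ≠ [] ∧ IsBlockWord len tail M N 0 w}

theorem isRegular_blockLanguage : (blockLanguage len tail M N).IsRegular := by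
  let L : ℕ → Language A := fun o => {w | IsBlockWord len tail M N o w}
  let L' : Language A := {w | ∀ b ∈ w, b ∈ tail}
  have hstep : ∀ o a, (L o).leftQuotient [a] ∈ insert L' (L '' Set.Iic N) := by
    intro o a
    by_cases h : M ≤ o + len a ∧ o + len a ≤ M + N
    · right
      refine ⟨o + len a - M, by simp only [Set.mem_Iic]; omega, ?_⟩
      ext w
      change IsBlockWord len tail M N _ w ↔ IsBlockWord len tail M N o (a :: w)
      simp [IsBlockWord, h]
    · left
      ext w
      change IsBlockWord len tail M N o (a :: w) ↔ ∀ b ∈ w, b ∈ tail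
      simp only [IsBlockWord, h]
      simp
  refine Language.isRegular_of_mem_finite
    (F := insert (blockLanguage len tail M N) (insert ⊥ (insert L' (L '' Set.Iic N))))
    ((((Set.finite_Iic N).image L).insert _).insert _ |>.insert _) ?_ (Set.mem_insert _ _)
  rintro K (rfl | rfl | rfl | ⟨o, -, rfl⟩) a
  · have : (blockLanguage len tail M N).leftQuotient [a] = (L 0).leftQuotient [a] := by
      ext w
      change (a :: w ≠ [] ∧ IsBlockWord len tail M N 0 (a :: w)) ↔
        IsBlockWord len tail M N 0 (a :: w)
      simp
    rw [this]
    exact .inr (.inr (hstep 0 a))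
  · exact .inr (.inl rfl)
  · by_cases ha : a ∈ tail
    · refine .inr (.inr (.inl ?_))
      ext w
      change (∀ b ∈ a :: w, b ∈ tail) ↔ ∀ b ∈ w, b ∈ tail
      simp [ha]
    · refine .inr (.inl ?_)
      ext w
      change (∀ b ∈ a :: w, b ∈ tail) ↔ False
      simp [ha]
  · exact .inr (.inr (hstep o a))

variable {len tail M N}

theorem isBlockWord_of_forall_mem_tail {w : List A} (h : ∀ b ∈ w, b ∈ tail) (o : ℕ) :
    IsBlockWord len tail M N o w := by
  induction w generalizing o with
  | nil => trivial
  | cons a w ih =>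
    have hw : ∀ b ∈ w, b ∈ tail := fun b hb => h b (List.mem_cons_of_mem _ hb)
    exact ⟨fun _ => ih hw _, fun _ => hw⟩

theorem IsBlockWord.cons_of_forall_mem_tail {w : List A} (h : ∀ b ∈ w, b ∈ tail) (o : ℕ) (a : A) :
    IsBlockWord len tail M N o (a :: w) :=
  ⟨fun _ => isBlockWord_of_forall_mem_tail h _, fun _ => h⟩

theorem IsBlockWord.exists_append {o : ℕ} {w : List A} (h : IsBlockWord len tail M N o w)
    (ho : o ≤ N) : ∃ b t, w = b ++ t ∧ (∀ c ∈ t, c ∈ tail) ∧ ∀ j < b.length,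
      M * j ≤ o + ((b.take j).map len).sum ∧ o + ((b.take j).map len).sum ≤ M * j + N := by
  induction w generalizing o with
  | nil => exact ⟨[], [], rfl, by simp, by simp⟩
  | cons a w ih =>
    by_cases hr : M ≤ o + len a ∧ o + len a ≤ M + N
    · obtain ⟨b, t, rfl, ht, hb⟩ := ih (h.1 hr) (by omega)
      refine ⟨a :: b, t, rfl, ht, fun j hj => ?_⟩
      cases j with
      | zero => simpa using ho
      | succ j =>
        have := hb j (by simpa using hj)
        rw [List.take_succ_cons, List.map_cons, List.sum_cons, mul_add, mul_one]
        omega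
    · refine ⟨[a], w, rfl, h.2 hr, fun j hj => ?_⟩
      obtain rfl : j = 0 := by simpa using hj
      simpa using ho

end BlockWords

variable {m n : ℕ}

theorem prod_map_of_forall_mem_tail {A : Type*} {ψ : A → BSMonoid m n} {M : ℕ}
    {t : List A} (ht : ∀ a ∈ t, ψ a = gen m .x ^ M) :
    (t.map ψ).prod = gen m .x ^ (M * t.length) := by
  rw [List.map_congr_left (g := fun _ => gen m .x ^ M) ht]
  simp [pow_mul]

variable [NeZero n]

theorem yCount_prod_map {A : Type*} (ψ : A → BSMonoid m n) (w : List A) :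
    yCount (w.map ψ).prod = (w.map fun a => yCount (ψ a)).sum := by
  induction w with
  | nil => simp
  | cons a w ih => simp [ih]

/-- A bound for the deviation of block words from straight lines. -/
def deviation (m n M N K : ℕ) : ℕ :=
  n * (K + m) + K + 2 * M + 2 * N

theorem tailExp_mul_le_of_le (hmn : m < n) {K : ℕ} {s t : BSMonoid m n}
    (hs : tailExp s ≤ n * (K + m)) (ht : tailExp t ≤ K) :
    tailExp (s * t) ≤ n * (K + m) + K := by
  rw [tailExp_mul]
  by_cases h : digits t = []
  · rw [h, carryOut]; omega
  · have := carryOut_add_le hmn h hs; omega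

section Tracking

variable {A : Type*} {ψ : A → BSMonoid m n} {M N K : ℕ}

theorem tailExp_take_le (hmn : m < n) (hNM : N < M) (hK : ∀ a, tailExp (ψ a) ≤ K) {b : List A}
    (hb : ∀ j < b.length, M * j ≤ yCount ((b.take j).map ψ).prod ∧
      yCount ((b.take j).map ψ).prod ≤ M * j + N) (j : ℕ) (hj : j < b.length) :
    tailExp ((b.take j).map ψ).prod ≤ n * (K + m) := by
  induction j with
  | zero => simp
  | succ j ih =>
    have h₁ := hb j (by omega)
    have h₂ := hb (j + 1) hj
    have h₃ := ih (by omega)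
    rw [List.take_succ_eq_append_getElem (by omega), List.map_append, List.prod_append] at h₂ ⊢
    simp only [List.map_cons, List.map_nil, List.prod_singleton] at h₂ ⊢
    rw [yCount_mul, mul_add] at h₂
    have h₄ := carryOut_add_le (ds := digits (ψ b[j])) hmn
      (List.ne_nil_of_length_pos (show 0 < yCount (ψ b[j]) by omega)) h₃
    have := hK b[j]
    rw [tailExp_mul]
    omega

theorem block_bounds (hmn : m < n) (hNM : N < M) (hy : ∀ a, yCount (ψ a) ≤ M + N)
    (hK : ∀ a, tailExp (ψ a) ≤ K) {b : List A}
    (hb : ∀ j < b.length, M * j ≤ yCount ((b.take j).map ψ).prod ∧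
      yCount ((b.take j).map ψ).prod ≤ M * j + N) :
    M * b.length ≤ yCount (b.map ψ).prod + M ∧ yCount (b.map ψ).prod ≤ M * b.length + 2 * N ∧
      tailExp (b.map ψ).prod ≤ n * (K + m) + K := by
  rcases List.eq_nil_or_concat b with rfl | ⟨c, a, rfl⟩
  · simp
  · have h₁ := hb c.length (by simp)
    have h₂ := tailExp_take_le hmn hNM hK hb c.length (by simp)
    have h₃ := hy a
    have h₄ := hK a
    simp only [List.concat_eq_append, List.take_left', List.map_append, List.prod_append,
      List.map_cons, List.map_nil, List.prod_singleton, yCount_mul, List.length_append,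
      List.length_singleton, mul_add M] at h₁ h₂ ⊢
    have := tailExp_mul_le_of_le hmn h₂ h₄
    omega

/-- The normal forms of the prefixes of a block word follow, up to a bounded error, the path which
first increases the `y`-count to its final value and then the exponent at the end. -/
theorem block_word_tracking (hmn : m < n) (hNM : N < M) (hy : ∀ a, yCount (ψ a) ≤ M + N)
    (hK : ∀ a, tailExp (ψ a) ≤ K) {w : List A}
    (hw : w ∈ blockLanguage (fun a => yCount (ψ a)) {a | ψ a = gen m .x ^ M} M N) (j : ℕ)
    {s z : BSMonoid m n} (hs : s = ((w.take j).map ψ).prod) (hz : z = (w.map ψ).prod) :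
    yCount s ≤ yCount z ∧
    yCount s ≤ M * j + deviation m n M N K ∧
    min (M * j) (yCount z) ≤ yCount s + deviation m n M N K ∧
    tailExp s ≤ min (tailExp z) (M * j - yCount z) + deviation m n M N K ∧
    min (tailExp z) (M * j - yCount z) ≤ tailExp s + deviation m n M N K ∧
    (yCount s < yCount z → tailExp s ≤ deviation m n M N K) := by
  obtain ⟨b, t, rfl, ht, hb⟩ := hw.2.exists_append (Nat.zero_le N)
  simp only [zero_add, ← yCount_prod_map] at hb
  obtain ⟨h₁, h₂, h₃⟩ := block_bounds hmn hNM hy hK hb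
  have hz' : z = (b.map ψ).prod * gen m .x ^ (M * t.length) := by
    rw [hz, List.map_append, List.prod_append, prod_map_of_forall_mem_tail ht]
  have hzy : yCount z = yCount (b.map ψ).prod := by rw [hz']; simp
  have hzt : tailExp z = tailExp (b.map ψ).prod + M * t.length := by
    rw [hz', tailExp_mul_gen_x_pow]
  unfold deviation
  by_cases hj : j < b.length
  · have h₄ := hb j hj
    have h₅ := tailExp_take_le hmn hNM hK hb j hj
    have h₆ : yCount (b.map ψ).prod =
        yCount ((b.take j).map ψ).prod + yCount ((b.drop j).map ψ).prod := by
      rw [← yCount_mul, ← List.prod_append, ← List.map_append, List.take_append_drop]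
    rw [List.take_append_of_le_length hj.le] at hs
    subst hs
    omega
  · obtain ⟨i, rfl⟩ := Nat.exists_eq_add_of_le (Nat.le_of_not_lt hj)
    have hs' : s = (b.map ψ).prod * gen m .x ^ (M * min i t.length) := by
      rw [hs, List.take_length_add_append, List.map_append, List.prod_append,
        prod_map_of_forall_mem_tail fun a ha => ht a (List.mem_of_mem_take ha), List.length_take]
    have hsy : yCount s = yCount (b.map ψ).prod := by rw [hs']; simp
    have hst : tailExp s = tailExp (b.map ψ).prod + M * min i t.length := by
      rw [hs', tailExp_mul_gen_x_pow]
    rw [mul_add]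
    obtain hi | hi := le_total i t.length
    · have := Nat.mul_le_mul_left M hi
      rw [min_eq_left hi] at hst
      omega
    · have := Nat.mul_le_mul_left M hi
      rw [min_eq_right hi] at hst
      omega

theorem isRegular_mulLanguage_blockLanguage (hmn : m < n) (hNM : N < M)
    (hy : ∀ a, yCount (ψ a) ≤ M + N) (hK : ∀ a, tailExp (ψ a) ≤ K) (g : BSMonoid m n) :
    (AutomaticSemigroup.mulLanguage ψ
      (blockLanguage (fun a => yCount (ψ a)) {a | ψ a = gen m .x ^ M} M N) g).IsRegular := by
  obtain ⟨G, hG⟩ := exists_tailExp_mul_le hmn g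
  set C := 4 * deviation m n M N K + 2 * G + 2 * yCount g
  have hF := finite_setOf_bounded (m := m) (n := n) C C
  refine AutomaticSemigroup.isRegular_mulLanguage ψ (isRegular_blockLanguage _ _ _ _) g
    (hF.prod hF) fun u hu v hv huv j => ?_
  have h : g * ((u.take j).map ψ).prod * ((u.drop j).map ψ).prod =
      ((v.take j).map ψ).prod * ((v.drop j).map ψ).prod := by
    rw [mul_assoc, ← List.prod_append, ← List.prod_append, ← List.map_append, ← List.map_append,
      List.take_append_drop, List.take_append_drop, huv]
  have hu' := block_word_tracking hmn hNM hy hK hu j rfl rfl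
  have hv' := block_word_tracking hmn hNM hy hK hv j rfl rfl
  rw [← huv] at hv'
  have h₁ := hG ((u.take j).map ψ).prod
  have h₂ := hG (u.map ψ).prod
  have h₃ := yCount_mul g (u.map ψ).prod
  have h₄ := yCount_mul g ((u.take j).map ψ).prod
  obtain ⟨k, p, q, hp, hq, e₁, e₂⟩ := exists_common_left_divisor h (C := C)
    (by omega) (by omega) (by omega)
  exact ⟨k, (p, q), ⟨hp, hq⟩, e₁, e₂⟩

end Tracking

/-- Every element of a decomposable submonoid is represented by a block word over an alphabet that
represents all its elements of bounded size. -/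
theorem IsBlockDecomposable.exists_isBlockWord (hmn : m < n) {T : Submonoid (BSMonoid m n)}
    {N M K D : ℕ} (H : IsBlockDecomposable T N M K D) {A : Type*} {ψ : A → BSMonoid m n}
    (hψ : ∀ t ∈ T, t ≠ 1 → yCount t ≤ M + N → tailExp t ≤ n * (K + m) + D + M → ∃ a, ψ a = t)
    {t : BSMonoid m n} (ht : t ∈ T) {o : ℕ} (ho : o ≤ N) :
    ∃ w, IsBlockWord (fun a => yCount (ψ a)) {a | ψ a = gen m .x ^ M} M N o w ∧
      (w.map ψ).prod = t := by
  have hN := H.pos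
  have hNM := H.lt
  induction hk : yCount t using Nat.strong_induction_on generalizing t o with
  | _ k ih =>
    subst hk
    obtain ⟨h, hh, t', ht', rfl, hE, h₁, h₂⟩ | ⟨h, hh, p, hp, rfl, hE, h₁⟩ :=
      H.exists_factor hmn (M - o) ht
    · obtain ⟨a, rfl⟩ := hψ h hh (by rintro rfl; simp at h₁; omega) (by omega) (by omega)
      obtain ⟨w, hw, rfl⟩ := ih (yCount t') (by rw [yCount_mul]; omega) ht'
        (o := o + yCount (ψ a) - M) (by omega) rfl
      exact ⟨a :: w, ⟨fun _ => hw, fun hn => (hn (by dsimp only; omega)).elim⟩, by simp⟩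
    · obtain ⟨q, r, rfl, hr, hrD, hq⟩ := H.exists_remainder p hp
      obtain ⟨w, hw, hwq⟩ : ∃ w : List A, (∀ b ∈ w, ψ b = gen m .x ^ M) ∧
          (w.map ψ).prod = gen m .x ^ (M * q) := by
        obtain rfl | hq := hq
        · exact ⟨[], by simp, by simp⟩
        · obtain ⟨a, ha⟩ := hψ _ hq
            (fun e => by have := congrArg tailExp e; simp at this; omega) (by simp) (by simp)
          exact ⟨List.replicate q a, by simp [ha], by simp [ha, pow_mul]⟩
      have e : h * gen m .x ^ (M * q + r) = h * gen m .x ^ r * gen m .x ^ (M * q) := by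
        rw [mul_assoc, ← pow_add, add_comm]
      by_cases hf : h * gen m .x ^ r = 1
      · exact ⟨w, isBlockWord_of_forall_mem_tail hw o, by rw [hwq, e, hf, one_mul]⟩
      · obtain ⟨a, ha⟩ := hψ _ (mul_mem hh hr) hf (by simp; omega)
          (by rw [tailExp_mul_gen_x_pow]; omega)
        exact ⟨a :: w, .cons_of_forall_mem_tail hw o a, by
          rw [List.map_cons, List.prod_cons, ha, hwq, e]⟩

end BaumslagSolitar

namespace AutomaticSemigroup

theorem exists_letters_eq {A : Type*} {l : List A} (hl : l ≠ []) :
    ∃ w : FreeSemigroup A, letters w = l := by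
  cases l with
  | nil => exact (hl rfl).elim
  | cons a l => exact ⟨⟨a, l⟩, rfl⟩

theorem lift_mem_closure {S A : Type*} [Semigroup S] (φ : A → S) (w : FreeSemigroup A) :
    FreeSemigroup.lift φ w ∈ Subsemigroup.closure (Set.range φ) := by
  induction w with
  | ih1 a => exact Subsemigroup.subset_closure ⟨a, (FreeSemigroup.lift_of φ a).symm⟩
  | ih2 a w h₁ h₂ => rw [map_mul]; exact mul_mem h₁ h₂

theorem map_lift_eq_prod {S A M : Type*} [Semigroup S] [Monoid M] (f : S →ₙ* M) (φ : A → S)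
    (w : FreeSemigroup A) :
    f (FreeSemigroup.lift φ w) = ((letters w).map fun a => f (φ a)).prod := by
  induction w with
  | ih1 a => simp [letters]
  | ih2 a w h₁ h₂ =>
    rw [FreeSemigroup.lift_of_mul, map_mul, h₂]
    simp [letters]

theorem padLanguage_eq_mulLanguage {S A M : Type*} [Semigroup S] [Monoid M] (f : S →ₙ* M)
    (hf : Function.Injective f) (φ : A → S) {L : Language A} (hL : [] ∉ L) (g : M)
    (r : S → S) (hr : ∀ s, f (r s) = g * f s) :
    padLanguage {p | letters p.1 ∈ L ∧ letters p.2 ∈ L ∧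
      r (FreeSemigroup.lift φ p.1) = FreeSemigroup.lift φ p.2} =
    mulLanguage (fun a => f (φ a)) L g := by
  have key : ∀ u v : FreeSemigroup A,
      r (FreeSemigroup.lift φ u) = FreeSemigroup.lift φ v ↔
        g * ((letters u).map fun a => f (φ a)).prod = ((letters v).map fun a => f (φ a)).prod := by
    intro u v
    rw [← hf.eq_iff, hr, map_lift_eq_prod, map_lift_eq_prod]
  ext l
  constructor
  · rintro ⟨u, v, ⟨hu, hv, huv⟩, rfl⟩
    exact ⟨_, _, hu, hv, (key u v).1 huv, rfl⟩
  · rintro ⟨u, v, hu, hv, huv, rfl⟩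
    obtain ⟨u, rfl⟩ := exists_letters_eq (ne_of_mem_of_not_mem hu hL)
    obtain ⟨v, rfl⟩ := exists_letters_eq (ne_of_mem_of_not_mem hv hL)
    exact ⟨u, v, ⟨hu, hv, (key u v).2 huv⟩, rfl⟩

end AutomaticSemigroup

open AutomaticSemigroup BaumslagSolitar

theorem Subsemigroup.coe_mem_closure_image_iff {S : Type*} [Semigroup S] (X : Set S) (s : S) :
    (s : WithOne S) ∈ Submonoid.closure (WithOne.coe '' X) ↔ s ∈ Subsemigroup.closure X := by
  constructor
  · have : ∀ z ∈ Submonoid.closure (WithOne.coe '' X), z = 1 ∨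
        ∃ t ∈ Subsemigroup.closure X, (t : WithOne S) = z := by
      intro z hz
      induction hz using Submonoid.closure_induction_left with
      | one => exact .inl rfl
      | mul_left g hg z hz ih =>
        obtain ⟨x, hx, rfl⟩ := hg
        right
        obtain rfl | ⟨t, ht, rfl⟩ := ih
        · exact ⟨x, Subsemigroup.subset_closure hx, (mul_one _).symm⟩
        · exact ⟨x * t, mul_mem (Subsemigroup.subset_closure hx) ht, rfl⟩
    intro hs
    obtain h | ⟨t, ht, e⟩ := this s hs
    · exact (WithOne.coe_ne_one h).elim
    · exact WithOne.coe_inj.1 e ▸ ht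
  · intro hs
    induction hs using Subsemigroup.closure_induction with
    | mem x hx => exact Submonoid.subset_closure ⟨x, hx, rfl⟩
    | mul x y _ _ hx hy => rw [WithOne.coe_mul]; exact mul_mem hx hy

theorem theorem2 (m n : ℕ) (hm : 0 < m) (hmn : m < n)
    (T : Subsemigroup (BaumslagSolitarSemigroup m n)) (hT : T.IsFinitelyGenerated) :
    IsLeftAutomatic T := by
  have : NeZero n := ⟨by omega⟩
  obtain ⟨X, hX, rfl⟩ := hT
  set T := Subsemigroup.closure X
  obtain ⟨N, M, K, D, H⟩ := exists_isBlockDecomposable hm hmn (hX.image WithOne.coe)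
  let f : T →ₙ* BSMonoid m n := WithOne.coeMulHom.comp (MulMemClass.subtype T)
  have hf : Function.Injective f := WithOne.coe_injective.comp Subtype.val_injective
  let A : Type := {t : T // yCount (f t) ≤ M + N ∧ tailExp (f t) ≤ n * (K + m) + D + M}
  let φ : A → T := Subtype.val
  let ψ : A → BSMonoid m n := fun a => f (φ a)
  let L : Language A := blockLanguage (fun a => yCount (ψ a)) {a | ψ a = gen m .x ^ M} M N
  have hL : [] ∉ L := fun h => h.1 rfl
  have hψ : ∀ t ∈ Submonoid.closure (WithOne.coe '' X), t ≠ 1 → yCount t ≤ M + N →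
      tailExp t ≤ n * (K + m) + D + M → ∃ a, ψ a = t := by
    intro t ht h1 hy hE
    obtain ⟨s, rfl⟩ := WithOne.ne_one_iff_exists.1 h1
    exact ⟨⟨⟨s, (Subsemigroup.coe_mem_closure_image_iff X s).1 ht⟩, hy, hE⟩, rfl⟩
  have hsurj : ∀ t : T, ∃ w : FreeSemigroup A, letters w ∈ L ∧ FreeSemigroup.lift φ w = t := by
    intro t
    obtain ⟨l, hl, hlt⟩ := H.exists_isBlockWord hmn hψ
      ((Subsemigroup.coe_mem_closure_image_iff X t.1).2 t.2) (Nat.zero_le N)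
    have hne : l ≠ [] := by
      rintro rfl
      exact WithOne.one_ne_coe hlt
    obtain ⟨w, rfl⟩ := exists_letters_eq hne
    exact ⟨w, ⟨hne, hl⟩, hf ((map_lift_eq_prod f φ w).trans hlt)⟩
  have hreg := isRegular_mulLanguage_blockLanguage hmn H.lt (fun a : A => a.2.1) (fun a => a.2.2)
  refine ⟨A, φ, {w | letters w ∈ L}, ?_, ?_, ?_, ?_, ?_, ?_⟩
  · exact (Set.Finite.preimage hf.injOn (finite_setOf_bounded (m := m) (n := n) _ _)).to_subtype
  · rw [eq_top_iff]
    rintro t -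
    obtain ⟨w, -, rfl⟩ := hsurj t
    exact lift_mem_closure φ w
  · have : wordLanguage {w | letters w ∈ L} = L := by
      ext l
      constructor
      · rintro ⟨w, hw, rfl⟩
        exact hw
      · intro hl
        obtain ⟨w, rfl⟩ := exists_letters_eq (ne_of_mem_of_not_mem hl hL)
        exact ⟨w, hl, rfl⟩
    rw [this]
    exact isRegular_blockLanguage _ _ _ _
  · exact Set.eq_univ_of_forall hsurj
  · have := padLanguage_eq_mulLanguage f hf φ hL 1 id fun s => (one_mul _).symm
    exact this ▸ hreg 1
  · intro a
    have := padLanguage_eq_mulLanguage f hf φ hL (ψ a) (fun s => φ a * s) fun s => map_mul f _ _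
    simp only [FreeSemigroup.lift_of_mul]
    exact this ▸ hreg (ψ a)
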